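/- Let $n\ge 2$ and let $B_n$ be the braid group on $n$ strands, with standard generators $\sigma_1,\dots,\sigma_{n-1}$ and relations $\sigma_i\sigma_j=\sigma_j\sigma_i$ for $|i-j|\ge 2$ and $\sigma_i\sigma_{i+1}\sigma_i=\sigma_{i+1}\sigma_i\sigma_{i+1}$ for $1\le i\le n-2$. Let $B_n^+\subset B_n$ be the monoid of positive braids, that is, the submonoid generated by $\sigma_1,\dots,\sigma_{n-1}$. For $\beta\in B_n^+$, let $\omega(\beta)$ be the lex-representative of $\beta$: the smallest word in $\sigma_1,\dots,\sigma_{n-1}$ representing $\beta$, with respect to the lexicographic order in which $\sigma_1<\sigma_2<\cdots<\sigma_{n-1}$ (all words representing $\beta$ have the same length). Let $L_n=\{\omega(\beta)\mid\beta\in B_n^+\}$. For $w\in L_n$, let $F_n(w)=\{\alpha\in B_n^+\mid w\,\omega(\alpha)\notin L_n\}$, where $w\,\omega(\alpha)$ is the concatenation of words, and let $F_n^{\min}(w)$ be the set of minimal elements of $F_n(w)$ with respect to the prefix order on $B_n^+$, in which $a\preccurlyeq b$ if and only if $ac=b$ for some $c\in B_n^+$. Then: 1. The set $\{F_n^{\min}(w)\mid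 w\in L_n\}$ is finite and has at least $2^{n-2}$ elements. 2. Every (deterministic, complete) finite state automaton over the alphabet $\{\sigma_1,\dots,\sigma_{n-1}\}$ that accepts exactly the language $L_n$ has at least $2^{n-2}$ states. -/

import Mathlib

namespace BraidLex

/-- The Artin relators of the braid group on `n` strands, in the free group on the generators
`σ_1, …, σ_{n-1}`.  The generator `σ_{i+1}` is indexed by `i : Fin (n - 1)`. -/
inductive ArtinRelator (n : ℕ) : FreeGroup (Fin (n - 1)) → Prop
  | comm (i j : Fin (n - 1)) (h : (i : ℕ) + 2 ≤ (j : ℕ)) :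
      ArtinRelator n
        (FreeGroup.of i * FreeGroup.of j * (FreeGroup.of j * FreeGroup.of i)⁻¹)
  | braid (i j : Fin (n - 1)) (h : (i : ℕ) + 1 = (j : ℕ)) :
      ArtinRelator n
        (FreeGroup.of i * FreeGroup.of j * FreeGroup.of i *
          (FreeGroup.of j * FreeGroup.of i * FreeGroup.of j)⁻¹)

/-- The braid group `B_n` on `n` strands. -/
abbrev BraidGroup (n : ℕ) : Type := PresentedGroup {r | ArtinRelator n r}

/-- The monoid `B_n^+` of positive braids: the submonoid of the braid group generated by the
standard generators. -/
abbrev PosBraid (n : ℕ) : Submonoid (BraidGroup n) :=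
  Submonoid.closure (Set.range fun i : Fin (n - 1) =>
    (PresentedGroup.of i : BraidGroup n))

/-- The atom `σ_{i+1}` of the monoid of positive braids. -/
def atom {n : ℕ} (i : Fin (n - 1)) : PosBraid n :=
  ⟨PresentedGroup.of i, Submonoid.subset_closure ⟨i, rfl⟩⟩

/-- Words in the atoms, that is, elements of the free monoid on `σ_1, …, σ_{n-1}`.  They carry the
lexicographic order coming from `σ_1 < σ_2 < ⋯ < σ_{n-1}`. -/
abbrev Word (n : ℕ) : Type := List (Fin (n - 1))

/-- The positive braid represented by a word. -/
def toBraid {n : ℕ} (w : Word n) : PosBraid n := (w.map atom).prod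

/-- The exponent sum on the braid group. -/
def expSum (n : ℕ) : BraidGroup n →* Multiplicative ℤ :=
  PresentedGroup.toGroup (f := fun _ => Multiplicative.ofAdd (1 : ℤ)) (by
    rintro r (⟨i, j, h⟩ | ⟨i, j, h⟩) <;> simp)

theorem expSum_toBraid {n : ℕ} (w : Word n) :
    expSum n (toBraid w : BraidGroup n) = Multiplicative.ofAdd (w.length : ℤ) := by
  induction w with
  | nil => simp [toBraid]
  | cons i w ih =>
    have h : (toBraid (i :: w) : BraidGroup n) =
        PresentedGroup.of i * (toBraid w : BraidGroup n) := by
      simp [toBraid, atom]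
    rw [h, map_mul, ih, expSum, PresentedGroup.toGroup.of, ← ofAdd_add]
    congr 1
    simp only [List.length_cons]
    push_cast
    ring

/-- All words that represent a given positive braid have the same length. -/
theorem length_eq_of_toBraid_eq {n : ℕ} {v w : Word n} (h : toBraid v = toBraid w) :
    v.length = w.length := by
  have h1 := expSum_toBraid v
  rw [h, expSum_toBraid w] at h1
  exact_mod_cast (Multiplicative.ofAdd.injective h1).symm

theorem toBraid_surjective (n : ℕ) : Function.Surjective (toBraid (n := n)) := by
  rintro ⟨x, hx⟩
  induction hx using Submonoid.closure_induction with
  | mem x h =>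
    obtain ⟨i, rfl⟩ := h
    exact ⟨[i], by simp [toBraid, atom]⟩
  | one => exact ⟨[], rfl⟩
  | mul x y hx hy ihx ihy =>
    obtain ⟨v, hv⟩ := ihx
    obtain ⟨w, hw⟩ := ihy
    refine ⟨v ++ w, ?_⟩
    have h : toBraid (v ++ w) = toBraid v * toBraid w := by simp [toBraid]
    rw [h, hv, hw]
    rfl

theorem exists_isLeast_word {n : ℕ} (β : PosBraid n) :
    ∃ w : Word n, IsLeast {v : Word n | toBraid v = β} w := by
  obtain ⟨w₀, h₀⟩ := toBraid_surjective n β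
  have hfin : {v : Word n | toBraid v = β}.Finite :=
    (List.finite_length_eq (Fin (n - 1)) w₀.length).subset fun v hv =>
      length_eq_of_toBraid_eq (hv.trans h₀.symm)
  obtain ⟨w, hw, hmin⟩ := Set.exists_min_image _ id hfin ⟨w₀, h₀⟩
  exact ⟨w, hw, fun v hv => hmin v hv⟩

/-- The lex-representative `ω(β)` of a positive braid `β`: the lexicographically smallest word
that represents `β`. -/
noncomputable def lexRep {n : ℕ} (β : PosBraid n) : Word n :=
  Classical.choose (exists_isLeast_word β)

theorem lexRep_isLeast {n : ℕ} (β : PosBraid n) :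
    IsLeast {v : Word n | toBraid v = β} (lexRep β) :=
  Classical.choose_spec (exists_isLeast_word β)

/-- The language `L_n` of lex-representatives. -/
def lexLanguage (n : ℕ) : Language (Fin (n - 1)) :=
  {w : Word n | ∃ β : PosBraid n, lexRep β = w}

/-- `a` is a prefix of `b` in the monoid of positive braids. -/
def IsPrefix {n : ℕ} (a b : PosBraid n) : Prop := ∃ c : PosBraid n, a * c = b

/-- The set `F_n(w)` of forbidden prefixes after the word `w`. -/
def forbidden {n : ℕ} (w : Word n) : Set (PosBraid n) :=
  {α | w ++ lexRep α ∉ lexLanguage n}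

/-- The set `F_n^min(w)` of minimal forbidden prefixes after the word `w`: the minimal elements of
`F_n(w)` with respect to the prefix order. -/
def minForbidden {n : ℕ} (w : Word n) : Set (PosBraid n) :=
  {α | α ∈ forbidden w ∧ ∀ β ∈ forbidden w, IsPrefix β α → β = α}

end BraidLex

/-! Finiteness. A word `w ++ lexRep α` leaves the language exactly when, for some suffix `a :: x` of
`w`, an atom smaller than `a` is a prefix of the braid `a x α`. Let `c` be a central positive braid
having every atom as a prefix (a power of σ_1⋯σ_{n-1}). Any such divisibility is already caused by a
prefix of `α` that is also a prefix of `c` (`exists_prefix_complement`), so minimal forbidden braids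
are prefixes of `c`, and there are finitely many of these. The argument needs greatest common
prefixes, hence the shape of common multiples of two atoms in the positive monoid. That comes from
Garside's key lemma for the monoid given by the braid relations (`complement_of_gen_mul_eq`), which
is then identified with the submonoid of the braid group by embedding it in a localization at `c`.

Lower bound. In σ_{n-1}^{e_{n-1}}⋯σ_1^{e_1} with all exponents 1 or 2, appending σ_{b+1} stays in
the language if e_b = 2. If e_b = 1 it fails, because σ_{b+1} slides left and σ_{b+1}σ_bσ_{b+1} =
σ_bσ_{b+1}σ_b. The forbidden atoms thus recover the n-2 free exponents e_1, …, e_{n-2}. Since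
forbidden sets depend only on the state an automaton reaches, the same bound holds for its states.
-/

/-! ### Artin monoids of triangle-free graphs: Garside's key lemma and left cancellation -/

/-- Positive braid equivalence of words in the vertices of a graph `G`: adjacent letters satisfy the
braid relation, distinct non-adjacent letters commute. -/
inductive WordEq {α : Type*} (G : SimpleGraph α) : List α → List α → Prop
  | refl (u : List α) : WordEq G u u
  | symm {u v : List α} : WordEq G u v → WordEq G v u
  | trans {u v w : List α} : WordEq G u v → WordEq G v w → WordEq G u w
  | cons (a : α) {u v : List α} : WordEq G u v → WordEq G (a :: u) (a :: v)
  | comm (a b : α) (u : List α) : a ≠ b → ¬ G.Adj a b → WordEq G (a :: b :: u) (b :: a :: u)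
  | braid (a b : α) (u : List α) : G.Adj a b → WordEq G (a :: b :: a :: u) (b :: a :: b :: u)

namespace WordEq

variable {α : Type*} {G : SimpleGraph α}

theorem length_eq {u v : List α} (h : WordEq G u v) : u.length = v.length := by
  induction h <;> simp_all

theorem mem_iff {u v : List α} (h : WordEq G u v) (x : α) : x ∈ u ↔ x ∈ v := by
  induction h <;> simp_all <;> tauto

theorem append_right {u v : List α} (h : WordEq G u v) (w : List α) :
    WordEq G (u ++ w) (v ++ w) := by
  induction h with
  | refl u => exact .refl _
  | symm _ ih => exact ih.symm
  | trans _ _ ih₁ ih₂ => exact ih₁.trans ih₂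
  | cons a _ ih => exact ih.cons a
  | comm a b u h₁ h₂ => exact .comm a b _ h₁ h₂
  | braid a b u h => exact .braid a b _ h

theorem append_left (w : List α) {u v : List α} (h : WordEq G u v) :
    WordEq G (w ++ u) (w ++ v) := by
  induction w with
  | nil => exact h
  | cons a w ih => exact ih.cons a

end WordEq

/-- The congruence on the free monoid given by positive braid equivalence. -/
def wordCon {α : Type*} (G : SimpleGraph α) : Con (FreeMonoid α) where
  r u v := WordEq G u.toList v.toList
  iseqv := ⟨fun _ => .refl _, fun h => h.symm, fun h₁ h₂ => h₁.trans h₂⟩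
  mul' := fun h₁ h₂ => (h₁.append_right _).trans (h₂.append_left _)

/-- The simply laced Artin monoid of a graph. -/
abbrev ArtinMonoid {α : Type*} (G : SimpleGraph α) : Type _ := (wordCon G).Quotient

namespace ArtinMonoid

variable {α : Type*} {G : SimpleGraph α}

/-- The element of the Artin monoid represented by a word. -/
def ofWord (G : SimpleGraph α) (u : List α) : ArtinMonoid G :=
  ((FreeMonoid.ofList u : FreeMonoid α) : (wordCon G).Quotient)

/-- The generators of the Artin monoid. -/
def gen (G : SimpleGraph α) (a : α) : ArtinMonoid G := ofWord G [a]

theorem ofWord_eq_iff {u v : List α} : ofWord G u = ofWord G v ↔ WordEq G u v :=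
  (wordCon G).eq

theorem ofWord_surjective : Function.Surjective (ofWord G) := by
  intro x
  induction x using Con.induction_on with
  | H u => exact ⟨u.toList, rfl⟩

theorem ofWord_nil : ofWord G [] = 1 := rfl

theorem ofWord_cons (a : α) (u : List α) : ofWord G (a :: u) = gen G a * ofWord G u := rfl

theorem gen_comm {a b : α} (hab : a ≠ b) (h : ¬ G.Adj a b) :
    gen G a * gen G b = gen G b * gen G a :=
  ofWord_eq_iff.2 (.comm a b [] hab h)

theorem gen_braid {a b : α} (h : G.Adj a b) :
    gen G a * gen G b * gen G a = gen G b * gen G a * gen G b :=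
  ofWord_eq_iff.2 (.braid a b [] h)

/-- The possible shapes of an equality `gen i * x = gen j * y`. -/
inductive Complement (G : SimpleGraph α) (i j : α) (x y : ArtinMonoid G) : Prop
  | eq (hij : i = j) (h : x = y)
  | comm (hij : i ≠ j) (h : ¬ G.Adj i j) (z : ArtinMonoid G)
      (hx : x = gen G j * z) (hy : y = gen G i * z)
  | braid (h : G.Adj i j) (z : ArtinMonoid G)
      (hx : x = gen G j * (gen G i * z)) (hy : y = gen G i * (gen G j * z))

theorem Complement.symm {i j : α} {x y : ArtinMonoid G} (h : Complement G i j x y) :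
    Complement G j i y x := by
  cases h with
  | eq hij h => exact .eq hij.symm h.symm
  | comm hij h z hx hy => exact .comm hij.symm (fun h' => h h'.symm) z hy hx
  | braid h z hx hy => exact .braid h.symm z hy hx

theorem Complement.of_eq {i : α} {x y : ArtinMonoid G} (h : Complement G i i x y) : x = y := by
  cases h with
  | eq _ h => exact h
  | comm hij => exact absurd rfl hij
  | braid h => exact absurd h (G.loopless.irrefl i)

theorem Complement.of_not_adj {i j : α} {x y : ArtinMonoid G} (h : Complement G i j x y)
    (hij : i ≠ j) (hn : ¬ G.Adj i j) : ∃ z, x = gen G j * z ∧ y = gen G i * z := by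
  cases h with
  | eq h => exact absurd h hij
  | comm _ _ z hx hy => exact ⟨z, hx, hy⟩
  | braid h => exact absurd h hn

theorem Complement.of_adj {i j : α} {x y : ArtinMonoid G} (h : Complement G i j x y)
    (ha : G.Adj i j) :
    ∃ z, x = gen G j * (gen G i * z) ∧ y = gen G i * (gen G j * z) := by
  cases h with
  | eq h => exact absurd h ha.ne
  | comm _ hn => exact absurd ha hn
  | braid _ z hx hy => exact ⟨z, hx, hy⟩

section Relations

variable {M : Type*} [Monoid M] {i j k : M}

theorem mul_left_comm_of_comm (h : i * k = k * i) (v : M) : i * (k * v) = k * (i * v) := by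
  rw [← mul_assoc, h, mul_assoc]

theorem mul_braid_of_braid (h : i * k * i = k * i * k) (v : M) :
    i * (k * (i * v)) = k * (i * (k * v)) := by
  simpa only [mul_assoc] using congrArg (· * v) h

end Relations


/-- Equalities `gen i * x = gen j * y` with `x` shorter than `n` have the expected shape. -/
def ComplementBelow (G : SimpleGraph α) (len : ArtinMonoid G → ℕ) (n : ℕ) : Prop :=
  ∀ i j x y, len x < n → gen G i * x = gen G j * y → Complement G i j x y

section Transitivity

variable {len : ArtinMonoid G → ℕ} {n : ℕ} {i j k : α} {x y w : ArtinMonoid G}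

theorem gen_mul_comm {a b : α} (hab : a ≠ b) (h : ¬ G.Adj a b) (v : ArtinMonoid G) :
    gen G a * (gen G b * v) = gen G b * (gen G a * v) :=
  mul_left_comm_of_comm (gen_comm hab h) v

theorem gen_mul_braid {a b : α} (h : G.Adj a b) (v : ArtinMonoid G) :
    gen G a * (gen G b * (gen G a * v)) = gen G b * (gen G a * (gen G b * v)) :=
  mul_braid_of_braid (gen_braid h) v

/-- The two hypotheses factor `w` in two ways, starting with `i` and with `j`. Comparing these
factorizations, and then the shorter equalities that they produce, only uses `ih`; the braid
relations reassemble the common factor. -/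
theorem Complement.trans_adj_comm (hlen : ∀ a x, len (gen G a * x) = len x + 1)
    (ih : ComplementBelow G len n) (hn : len w = n)
    (hik : G.Adj i k) (hkj : k ≠ j) (nkj : ¬ G.Adj k j) (hij : i ≠ j)
    (h₁ : Complement G i k x w) (h₂ : Complement G k j w y) : Complement G i j x y := by
  obtain ⟨z, rfl, rfl⟩ := h₁.of_adj hik
  obtain ⟨z', hw, rfl⟩ := h₂.of_not_adj hkj nkj
  simp only [hlen] at hn
  by_cases aij : G.Adj i j
  · obtain ⟨t, h3, rfl⟩ := (ih _ _ _ _ (by rw [hlen]; omega) hw).of_adj aij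
    have h5 := congrArg len h3
    simp only [hlen] at h5
    obtain ⟨u, rfl, h4⟩ := (ih _ _ _ _ (by omega) h3).of_not_adj hkj nkj
    simp only [hlen] at h5 hn
    obtain ⟨v, rfl, rfl⟩ := (ih _ _ _ _ (by omega) h4).of_adj hik
    refine .braid aij (gen G k * (gen G i * (gen G j * v))) ?_ ?_
    · rw [gen_mul_braid aij, gen_mul_comm hkj nkj, ← gen_mul_comm hkj nkj v,
        gen_mul_braid hik.symm]
    · rw [← gen_mul_comm hkj nkj (gen G i * v), gen_mul_braid hik.symm, gen_mul_braid aij,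
        gen_mul_comm hkj nkj]
  · obtain ⟨t, h3, rfl⟩ := (ih _ _ _ _ (by rw [hlen]; omega) hw).of_not_adj hij aij
    obtain ⟨u, rfl, rfl⟩ := (ih _ _ _ _ (by omega) h3).of_not_adj hkj nkj
    refine .comm hij aij (gen G k * (gen G i * u)) ?_ ?_
    · rw [gen_mul_comm hij aij, gen_mul_comm hkj nkj]
    · rw [gen_mul_braid hik.symm]

theorem Complement.trans_adj_adj (hlen : ∀ a x, len (gen G a * x) = len x + 1)
    (ih : ComplementBelow G len n) (hn : len w = n)
    (hik : G.Adj i k) (hkj : G.Adj k j) (hij : i ≠ j) (nij : ¬ G.Adj i j)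
    (h₁ : Complement G i k x w) (h₂ : Complement G k j w y) : Complement G i j x y := by
  obtain ⟨z, rfl, rfl⟩ := h₁.of_adj hik
  obtain ⟨z', hw, rfl⟩ := h₂.of_adj hkj
  simp only [hlen] at hn
  obtain ⟨t, h3, h4⟩ := (ih _ _ _ _ (by rw [hlen]; omega) hw).of_not_adj hij nij
  have h5 := congrArg len h3
  have h6 := congrArg len h4
  simp only [hlen] at h5 h6
  obtain ⟨u, rfl, rfl⟩ := (ih _ _ _ _ (by omega) h3).of_adj hkj
  obtain ⟨v, rfl, h7⟩ := (ih _ _ _ _ (by omega) h4).of_adj hik.symm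
  simp only [hlen] at h5 h6 hn
  have h8 := (ih _ _ _ _ (by rw [hlen]; omega) h7).of_eq
  obtain ⟨s, rfl, rfl⟩ := (ih _ _ _ _ (by omega) h8.symm).of_not_adj hij nij
  refine .comm hij nij (gen G k * (gen G j * (gen G i * (gen G k * s)))) ?_ ?_
  · rw [gen_mul_comm hij nij (gen G k * (gen G i * s)), gen_mul_braid hik, gen_mul_braid hkj]
  · rw [← gen_mul_comm hij nij (gen G k * (gen G j * s)), ← gen_mul_braid hkj,
      gen_mul_braid hik.symm, gen_mul_comm hij nij]

theorem Complement.trans_comm_comm (hlen : ∀ a x, len (gen G a * x) = len x + 1)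
    (ih : ComplementBelow G len n) (hn : len w = n)
    (hik : i ≠ k) (nik : ¬ G.Adj i k) (hkj : k ≠ j) (nkj : ¬ G.Adj k j) (hij : i ≠ j)
    (h₁ : Complement G i k x w) (h₂ : Complement G k j w y) : Complement G i j x y := by
  obtain ⟨z, rfl, rfl⟩ := h₁.of_not_adj hik nik
  obtain ⟨z', hw, rfl⟩ := h₂.of_not_adj hkj nkj
  simp only [hlen] at hn
  by_cases aij : G.Adj i j
  · obtain ⟨t, rfl, rfl⟩ := (ih _ _ _ _ (by omega) hw).of_adj aij
    refine .braid aij (gen G k * t) ?_ ?_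
    · rw [gen_mul_comm hkj nkj, ← gen_mul_comm hik nik]
    · rw [← gen_mul_comm hik nik, gen_mul_comm hkj nkj]
  · obtain ⟨t, rfl, rfl⟩ := (ih _ _ _ _ (by omega) hw).of_not_adj hij aij
    refine .comm hij aij (gen G k * t) ?_ ?_
    · rw [gen_mul_comm hkj nkj]
    · rw [← gen_mul_comm hik nik]

/-- Complements compose, in the absence of triangles. -/
theorem Complement.trans (htri : ∀ a b c, G.Adj a b → G.Adj b c → ¬ G.Adj a c)
    (hlen : ∀ a x, len (gen G a * x) = len x + 1)
    (ih : ComplementBelow G len n) (hn : len w = n)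
    (h₁ : Complement G i k x w) (h₂ : Complement G k j w y) : Complement G i j x y := by
  by_cases hik : i = k
  · subst hik
    rwa [h₁.of_eq]
  by_cases hkj : k = j
  · subst hkj
    rwa [← h₂.of_eq]
  by_cases hij : i = j
  · subst hij
    refine .eq rfl ?_
    by_cases aik : G.Adj i k
    · obtain ⟨z, rfl, rfl⟩ := h₁.of_adj aik
      obtain ⟨z', hw, rfl⟩ := h₂.of_adj aik.symm
      simp only [hlen] at hn
      have h3 := (ih _ _ _ _ (by rw [hlen]; omega) hw).of_eq
      rw [(ih _ _ _ _ (by omega) h3).of_eq]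
    · obtain ⟨z, rfl, rfl⟩ := h₁.of_not_adj hik aik
      obtain ⟨z', hw, rfl⟩ := h₂.of_not_adj hkj (fun h => aik h.symm)
      simp only [hlen] at hn
      rw [(ih _ _ _ _ (by omega) hw).of_eq]
  by_cases aik : G.Adj i k
  · by_cases akj : G.Adj k j
    · exact h₁.trans_adj_adj hlen ih hn aik akj hij (htri _ _ _ aik akj) h₂
    · exact h₁.trans_adj_comm hlen ih hn aik hkj akj hij h₂
  · by_cases akj : G.Adj k j
    · exact (h₂.symm.trans_adj_comm hlen ih hn akj.symm (Ne.symm hik) (fun h => aik h.symm)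
        (Ne.symm hij) h₁.symm).symm
    · exact h₁.trans_comm_comm hlen ih hn hik aik hkj akj hij h₂

end Transitivity

/-- The length homomorphism of the Artin monoid. -/
def lengthHom : ArtinMonoid G →* Multiplicative ℕ :=
  (wordCon G).lift (FreeMonoid.lift fun _ => Multiplicative.ofAdd 1) (by
    intro u v h
    have key : ∀ u : FreeMonoid α, FreeMonoid.lift (fun _ => Multiplicative.ofAdd 1) u =
        Multiplicative.ofAdd u.toList.length := by
      intro u
      induction u using FreeMonoid.inductionOn' with
      | one => rfl
      | of_mul a u ih =>
        rw [map_mul, ih, FreeMonoid.lift_eval_of, ← ofAdd_add, FreeMonoid.toList_of_mul,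
          List.length_cons, add_comm]
    change FreeMonoid.lift _ u = FreeMonoid.lift _ v
    rw [key, key, WordEq.length_eq h])

/-- The length of an element of the Artin monoid. -/
def length (x : ArtinMonoid G) : ℕ := (lengthHom x).toAdd

theorem length_gen_mul (a : α) (x : ArtinMonoid G) : length (gen G a * x) = length x + 1 := by
  rw [length, map_mul, toAdd_mul, add_comm]
  rfl

theorem length_ofWord (u : List α) : length (ofWord G u) = u.length := by
  induction u with
  | nil => rfl
  | cons a u ih => rw [ofWord_cons, length_gen_mul, ih, List.length_cons]

/-- Garside's key lemma: an equality `gen i * x = gen j * y` factors through the least common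
multiple of the two generators. -/
theorem complement_of_gen_mul_eq (htri : ∀ a b c, G.Adj a b → G.Adj b c → ¬ G.Adj a c)
    {i j : α} {x y : ArtinMonoid G} (h : gen G i * x = gen G j * y) : Complement G i j x y := by
  suffices H : ∀ n, ComplementBelow G length n from
    H _ i j x y (Nat.lt_succ_self _) h
  clear h x y i j
  intro n
  induction n with
  | zero => exact fun _ _ _ _ h => absurd h (Nat.not_lt_zero _)
  | succ n ih =>
    -- Induction on the derivation of the equivalence, inside the induction on length. Only
    -- transitivity is not immediate: it composes two complements, and for that needs the result on
    -- strictly shorter elements.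
    have key : ∀ u v, WordEq G u v → ∀ i u' j v', u = i :: u' → v = j :: v' → u'.length = n →
        Complement G i j (ofWord G u') (ofWord G v') := by
      intro u v h
      induction h with
      | refl u =>
        rintro i u' j v' rfl h -
        obtain ⟨rfl, rfl⟩ := List.cons_eq_cons.1 h
        exact .eq rfl rfl
      | symm h ih' =>
        rintro i u' j v' rfl rfl hl
        have := h.length_eq
        exact (ih' _ _ _ _ rfl rfl (by simp only [List.length_cons] at this; omega)).symm
      | @trans u v w h₁ h₂ ih₁ ih₂ =>
        rintro i u' j w' rfl rfl hl
        have := h₁.length_eq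
        obtain _ | ⟨k, v'⟩ := v
        · simp at this
        simp only [List.length_cons, Nat.add_right_cancel_iff] at this
        refine (ih₁ _ _ _ _ rfl rfl hl).trans htri length_gen_mul ih ?_
          (ih₂ _ _ _ _ rfl rfl (this ▸ hl))
        rw [length_ofWord, ← this, hl]
      | cons a h =>
        rintro i u' j v' hu hv -
        obtain ⟨rfl, rfl⟩ := List.cons_eq_cons.1 hu
        obtain ⟨rfl, rfl⟩ := List.cons_eq_cons.1 hv
        exact .eq rfl (ofWord_eq_iff.2 h)
      | comm a b u hab h =>
        rintro i u' j v' hu hv -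
        obtain ⟨rfl, rfl⟩ := List.cons_eq_cons.1 hu
        obtain ⟨rfl, rfl⟩ := List.cons_eq_cons.1 hv
        exact .comm hab h (ofWord G u) rfl rfl
      | braid a b u h =>
        rintro i u' j v' hu hv -
        obtain ⟨rfl, rfl⟩ := List.cons_eq_cons.1 hu
        obtain ⟨rfl, rfl⟩ := List.cons_eq_cons.1 hv
        exact .braid h (ofWord G u) rfl rfl
    intro i j x y hx h
    rcases Nat.lt_succ_iff_lt_or_eq.1 hx with hx | hx
    · exact ih i j x y hx h
    · obtain ⟨u, rfl⟩ := ofWord_surjective x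
      obtain ⟨v, rfl⟩ := ofWord_surjective y
      exact key (i :: u) (j :: v) (ofWord_eq_iff.1 h) i u j v rfl rfl (by rwa [length_ofWord] at hx)

theorem mul_left_cancel_of_no_triangle (htri : ∀ a b c, G.Adj a b → G.Adj b c → ¬ G.Adj a c)
    {x y z : ArtinMonoid G} (h : x * y = x * z) : y = z := by
  obtain ⟨u, rfl⟩ := ofWord_surjective x
  induction u with
  | nil => simpa only [ofWord_nil, one_mul] using h
  | cons a u ih =>
    rw [ofWord_cons, mul_assoc, mul_assoc] at h
    exact ih (complement_of_gen_mul_eq htri h).of_eq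

end ArtinMonoid

/-! ### A central power of the product of the generators -/

/-- The first `m` terms of the sequence `s` satisfy the braid relations. -/
structure BraidRelations {M : Type*} [Monoid M] (s : ℕ → M) (m : ℕ) : Prop where
  comm : ∀ i j, i + 2 ≤ j → j < m → s i * s j = s j * s i
  braid : ∀ i, i + 1 < m → s i * s (i + 1) * s i = s (i + 1) * s i * s (i + 1)

/-- The product `s 0 * s 1 * ⋯ * s (k - 1)`. -/
def ascProd {M : Type*} [Monoid M] (s : ℕ → M) : ℕ → M
  | 0 => 1
  | k + 1 => ascProd s k * s k

theorem ascProd_succ' {M : Type*} [Monoid M] (s : ℕ → M) (k : ℕ) :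
    ascProd s (k + 1) = s 0 * ascProd (fun i => s (i + 1)) k := by
  induction k with
  | zero => simp [ascProd]
  | succ k ih => rw [ascProd, ih, ascProd, mul_assoc]

namespace BraidRelations

variable {M : Type*} [Monoid M] {s : ℕ → M} {m : ℕ}

theorem ascProd_mul_of_lt (h : BraidRelations s m) {k j : ℕ} (hj : j < m) (hk : k < j) :
    ascProd s k * s j = s j * ascProd s k := by
  induction k with
  | zero => simp [ascProd]
  | succ k ih =>
    rw [ascProd, mul_assoc, h.comm k j (by omega) hj, ← mul_assoc, ih (by omega), mul_assoc]

/-- The letter `s i` passes left through the later factors, turns into `s (i + 1)` by the braid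
relation at `s i * s (i + 1)`, and passes the earlier factors. -/
theorem ascProd_mul (h : BraidRelations s m) {k i : ℕ} (hk : k ≤ m) (hi : i + 1 < k) :
    ascProd s k * s i = s (i + 1) * ascProd s k := by
  induction k with
  | zero => omega
  | succ k ih =>
    rcases Nat.lt_or_ge (i + 1) k with hik | hik
    · rw [ascProd, mul_assoc, ← h.comm i k (by omega) (by omega), ← mul_assoc,
        ih (by omega) hik, mul_assoc]
    · obtain rfl : k = i + 1 := by omega
      rw [ascProd, ascProd, mul_assoc, mul_assoc, ← mul_assoc (s i), h.braid i (by omega),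
        mul_assoc (s (i + 1)), ← mul_assoc, h.ascProd_mul_of_lt (by omega) (by omega), mul_assoc,
        mul_assoc (ascProd s i)]

theorem ascProd_mul_ascProd (h : BraidRelations s m) {k : ℕ} (hk : k < m) :
    ascProd s m * ascProd s k = ascProd (fun i => s (i + 1)) k * ascProd s m := by
  induction k with
  | zero => simp [ascProd]
  | succ k ih =>
    rw [ascProd, ← mul_assoc, ih (by omega), mul_assoc, h.ascProd_mul le_rfl hk, ascProd,
      mul_assoc]

/-- This closes the cycle: conjugation by δ = `ascProd` shifts indices up by one, and δ² takes the
last generator back to the first. -/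
theorem ascProd_sq_mul (h : BraidRelations s (m + 1)) :
    ascProd s (m + 1) ^ 2 * s m = s 0 * ascProd s (m + 1) ^ 2 := by
  have h1 : ascProd s (m + 1) ^ 2 =
      ascProd (fun i => s (i + 1)) m * ascProd s (m + 1) * s m := by
    rw [← h.ascProd_mul_ascProd (Nat.lt_succ_self m), sq, mul_assoc _ (ascProd s m)]
    rfl
  conv_rhs => rw [h1, ← mul_assoc, ← mul_assoc, ← ascProd_succ', ← sq]

theorem ascProd_pow_mul (h : BraidRelations s m) {i j : ℕ} (hij : i + j < m) :
    ascProd s m ^ j * s i = s (i + j) * ascProd s m ^ j := by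
  induction j with
  | zero => simp
  | succ j ih =>
    rw [pow_succ', mul_assoc, ih (by omega), ← mul_assoc, h.ascProd_mul le_rfl (by omega),
      mul_assoc, Nat.add_assoc]

/-- Moving `s i` around the whole cycle takes `m + 1` factors δ: `m - 1 - i` to reach the last
generator, two to return to `s 0`, and `i` to come back to `s i`. -/
theorem ascProd_pow_comm (h : BraidRelations s m) {i : ℕ} (hi : i < m) :
    s i * ascProd s m ^ (m + 1) = ascProd s m ^ (m + 1) * s i := by
  obtain ⟨p, rfl⟩ : ∃ p, m = p + 1 := ⟨m - 1, by omega⟩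
  have e : p + 1 + 1 = i + 2 + (p - i) := by omega
  have h1 := h.ascProd_pow_mul (i := i) (j := p - i) (by omega)
  have h2 := h.ascProd_pow_mul (i := 0) (j := i) (by omega)
  rw [Nat.add_sub_cancel' (by omega)] at h1
  rw [Nat.zero_add] at h2
  rw [e, pow_add, pow_add, mul_assoc _ _ (s i), h1, ← mul_assoc _ (s p),
    mul_assoc _ _ (s p), h.ascProd_sq_mul, ← mul_assoc (_ ^ i), h2]
  simp only [mul_assoc]

theorem exists_mul_eq_ascProd_pow (h : BraidRelations s m) {i : ℕ} (hi : i < m) :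
    ∃ t, s i * t = ascProd s m ^ (m + 1) := by
  obtain ⟨p, rfl⟩ : ∃ p, m = p + 1 := ⟨m - 1, by omega⟩
  have e : p + 1 + 1 = i + 1 + (p + 1 - i) := by omega
  have h2 := h.ascProd_pow_mul (i := 0) (j := i) (by omega)
  rw [Nat.zero_add] at h2
  -- Split off one δ = s_0⋯s_p after δ^i; its first letter s_0 moves left across δ^i and becomes
  -- s_i.
  refine ⟨ascProd s (p + 1) ^ i * ascProd (fun i => s (i + 1)) p *
    ascProd s (p + 1) ^ (p + 1 - i), ?_⟩
  rw [e, pow_add, pow_succ]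
  nth_rw 4 [ascProd_succ']
  rw [← mul_assoc, ← mul_assoc, ← h2]
  simp only [mul_assoc]

end BraidRelations

/-! ### Embedding in a group by Ore localization -/

/-- A left cancellative monoid whose generators all divide a central element embeds in a group. -/
theorem exists_units_hom_injective.{u} {M : Type u} [Monoid M]
    (hcancel : ∀ x y z : M, x * y = x * z → y = z) (c : M) (hc : ∀ x, x * c = c * x) :
    ∃ (T : Type u) (_ : Monoid T) (f : M →* T), Function.Injective f ∧
      ∀ x y, x * y = c → IsUnit (f x) := by
  classical
  have hcomm : ∀ (s : Submonoid.powers c) (x : M), x * s = s * x := by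
    rintro ⟨_, k, rfl⟩ x
    exact (show Commute x c from hc x).pow_right k
  let _ : OreLocalization.OreSet (Submonoid.powers c) :=
    { ore_right_cancel := fun x y s h => ⟨s, by rwa [← hcomm, ← hcomm]⟩
      oreNum := fun x _ => x
      oreDenom := fun _ s => s
      ore_eq := fun x s => (hcomm s x).symm }
  refine ⟨OreLocalization (Submonoid.powers c) M, inferInstance,
    OreLocalization.numeratorHom, fun x y h => ?_, fun x y h => ?_⟩
  · obtain ⟨u, v, h1, h2⟩ := OreLocalization.oreDiv_eq_iff.1 h
    simp only [OneMemClass.coe_one, mul_one] at h2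
    subst h2
    exact (hcancel _ _ _ h1).symm
  -- Centrality gives x(yx) = cx = xc, so left cancellation makes `x` and `y` commute, and a factor
  -- of the unit `c` is then a unit.
  · have h' : y * x = c := hcancel x _ _ (by rw [← mul_assoc, h, hc])
    have hu : IsUnit (OreLocalization.numeratorHom (S := Submonoid.powers c) (x * y)) := by
      rw [h]
      exact OreLocalization.numerator_isUnit ⟨c, Submonoid.mem_powers c⟩
    rw [map_mul] at hu
    refine (Commute.isUnit_mul_iff ?_).1 hu |>.1
    rw [Commute, SemiconjBy, ← map_mul, ← map_mul, h, h']

/-! ### Positive braids as the Artin monoid of the path graph -/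

namespace BraidLex

variable {m : ℕ}

theorem pathGraph_no_triangle (a b c : Fin m) (hab : (SimpleGraph.pathGraph m).Adj a b)
    (hbc : (SimpleGraph.pathGraph m).Adj b c) : ¬ (SimpleGraph.pathGraph m).Adj a c := by
  rw [SimpleGraph.pathGraph_adj] at *
  omega

/-- The generators of the Artin monoid of the path graph, extended by `1`. -/
def pathGen (m : ℕ) (i : ℕ) : ArtinMonoid (SimpleGraph.pathGraph m) :=
  if h : i < m then ArtinMonoid.gen _ ⟨i, h⟩ else 1

theorem pathGen_braidRelations (m : ℕ) : BraidRelations (pathGen m) m where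
  comm i j hij hj := by
    rw [pathGen, pathGen, dif_pos hj, dif_pos (by omega)]
    refine ArtinMonoid.gen_comm ?_ ?_
    · rw [Ne, Fin.mk.injEq]
      omega
    · rw [SimpleGraph.pathGraph_adj]
      dsimp only
      omega
  braid i hi := by
    rw [pathGen, pathGen, dif_pos hi, dif_pos (by omega)]
    refine ArtinMonoid.gen_braid ?_
    rw [SimpleGraph.pathGraph_adj]
    exact .inl rfl

variable {n : ℕ}

theorem toBraid_nil : toBraid ([] : Word n) = 1 := rfl

theorem toBraid_cons (i : Fin (n - 1)) (w : Word n) : toBraid (i :: w) = atom i * toBraid w := rfl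

theorem toBraid_append (v w : Word n) : toBraid (v ++ w) = toBraid v * toBraid w := by
  simp [toBraid]

/-- The monoid of positive braids embeds in the braid group. -/
theorem wordEq_of_toBraid_eq {u v : Word n} (h : toBraid u = toBraid v) :
    WordEq (SimpleGraph.pathGraph (n - 1)) u v := by
  have hrel := pathGen_braidRelations (n - 1)
  have hgen : ∀ i : Fin (n - 1), pathGen (n - 1) i = ArtinMonoid.gen _ i := fun i =>
    dif_pos i.2
  have hcentral : ∀ x : ArtinMonoid (SimpleGraph.pathGraph (n - 1)),
      x * ascProd (pathGen (n - 1)) (n - 1) ^ (n - 1 + 1) =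
        ascProd (pathGen (n - 1)) (n - 1) ^ (n - 1 + 1) * x := by
    intro x
    obtain ⟨u, rfl⟩ := ArtinMonoid.ofWord_surjective x
    induction u with
    | nil => rw [ArtinMonoid.ofWord_nil, one_mul, mul_one]
    | cons a u ih =>
      rw [ArtinMonoid.ofWord_cons, mul_assoc, ih, ← mul_assoc, ← hgen,
        hrel.ascProd_pow_comm a.2, mul_assoc]
  obtain ⟨T, _, f, hf, hunit⟩ := exists_units_hom_injective
    (fun x y z => ArtinMonoid.mul_left_cancel_of_no_triangle pathGraph_no_triangle) _ hcentral
  have hu : ∀ i : Fin (n - 1), IsUnit (f (ArtinMonoid.gen _ i)) := fun i => by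
    obtain ⟨t, ht⟩ := hrel.exists_mul_eq_ascProd_pow i.2
    rw [← hgen]
    exact hunit _ _ ht
  -- The generators become units of `T` satisfying the Artin relations, so `f` factors through the
  -- braid group on positive words. An equality of braids therefore maps to an equality in `T`, and
  -- injectivity of `f` brings it back to the Artin monoid.
  let g : BraidGroup n →* Tˣ := PresentedGroup.toGroup (f := fun i => (hu i).unit) (by
    rintro r (⟨i, j, hij⟩ | ⟨i, j, hij⟩)
    · rw [map_mul, map_inv, mul_inv_eq_one]
      ext
      simp only [map_mul, FreeGroup.lift_apply_of, Units.val_mul, IsUnit.unit_spec]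
      rw [← map_mul, ← map_mul, ← hgen, ← hgen, hrel.comm i j hij j.2]
    · rw [map_mul, map_inv, mul_inv_eq_one]
      ext
      simp only [map_mul, FreeGroup.lift_apply_of, Units.val_mul, IsUnit.unit_spec]
      rw [← map_mul, ← map_mul, ← map_mul, ← map_mul, ← hgen, ← hgen, ← hij,
        hrel.braid i (by omega)])
  have hg : ∀ w : Word n, (g (toBraid w : BraidGroup n) : T) = f (ArtinMonoid.ofWord _ w) := by
    intro w
    induction w with
    | nil => simp [toBraid_nil, ArtinMonoid.ofWord_nil]
    | cons i w ih =>
      rw [toBraid_cons, ArtinMonoid.ofWord_cons, map_mul, ← ih, Submonoid.coe_mul, map_mul,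
        Units.val_mul]
      congr 1
      exact congrArg Units.val (PresentedGroup.toGroup.of _)
  refine ArtinMonoid.ofWord_eq_iff.1 (hf ?_)
  rw [← hg, ← hg, h]

/-- The braid relations hold for the atoms. -/
theorem atom_comm {i j : Fin (n - 1)} (hij : i ≠ j)
    (h : ¬ (SimpleGraph.pathGraph (n - 1)).Adj i j) : atom i * atom j = atom j * atom i := by
  have key : ∀ {i j : Fin (n - 1)}, (i : ℕ) + 2 ≤ j → atom i * atom j = atom j * atom i := by
    intro i j hij
    have h := PresentedGroup.one_of_mem (rels := {r | ArtinRelator n r}) (ArtinRelator.comm i j hij)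
    rw [map_mul, map_inv, mul_inv_eq_one] at h
    exact Subtype.ext h
  rw [SimpleGraph.pathGraph_adj] at h
  rw [Ne, Fin.ext_iff] at hij
  rcases Nat.lt_or_ge i j with h' | h'
  · exact key (by omega)
  · exact (key (by omega)).symm

theorem atom_braid {i j : Fin (n - 1)} (h : (SimpleGraph.pathGraph (n - 1)).Adj i j) :
    atom i * atom j * atom i = atom j * atom i * atom j := by
  have key : ∀ {i j : Fin (n - 1)}, (i : ℕ) + 1 = j →
      atom i * atom j * atom i = atom j * atom i * atom j := by
    intro i j hij
    have h := PresentedGroup.one_of_mem (rels := {r | ArtinRelator n r})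
      (ArtinRelator.braid i j hij)
    rw [map_mul, map_inv, mul_inv_eq_one] at h
    exact Subtype.ext h
  rw [SimpleGraph.pathGraph_adj] at h
  rcases h with h | h
  · exact key h
  · exact (key h).symm

theorem toBraid_eq_of_wordEq {u v : Word n} (h : WordEq (SimpleGraph.pathGraph (n - 1)) u v) :
    toBraid u = toBraid v := by
  induction h with
  | refl => rfl
  | symm _ ih => exact ih.symm
  | trans _ _ ih₁ ih₂ => exact ih₁.trans ih₂
  | cons a _ ih => rw [toBraid_cons, ih, toBraid_cons]
  | comm a b u hab h =>
    simp only [toBraid_cons, ← mul_assoc]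
    rw [atom_comm hab h]
  | braid a b u h =>
    simp only [toBraid_cons, ← mul_assoc]
    rw [atom_braid h]

theorem toBraid_eq_iff {u v : Word n} :
    toBraid u = toBraid v ↔ WordEq (SimpleGraph.pathGraph (n - 1)) u v :=
  ⟨wordEq_of_toBraid_eq, toBraid_eq_of_wordEq⟩

theorem complement_of_toBraid_eq {i j : Fin (n - 1)} {u v : Word n}
    (h : atom i * toBraid u = atom j * toBraid v) :
    ArtinMonoid.Complement (SimpleGraph.pathGraph (n - 1)) i j
      (ArtinMonoid.ofWord _ u) (ArtinMonoid.ofWord _ v) := by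
  rw [← toBraid_cons, ← toBraid_cons, toBraid_eq_iff, ← ArtinMonoid.ofWord_eq_iff] at h
  exact ArtinMonoid.complement_of_gen_mul_eq pathGraph_no_triangle h

theorem exists_eq_of_not_adj {i j : Fin (n - 1)} (hij : i ≠ j)
    (hn : ¬ (SimpleGraph.pathGraph (n - 1)).Adj i j) {x y : PosBraid n}
    (h : atom i * x = atom j * y) : ∃ z, x = atom j * z ∧ y = atom i * z := by
  obtain ⟨u, rfl⟩ := toBraid_surjective n x
  obtain ⟨v, rfl⟩ := toBraid_surjective n y
  obtain ⟨z, hx, hy⟩ := (complement_of_toBraid_eq h).of_not_adj hij hn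
  obtain ⟨w, rfl⟩ := ArtinMonoid.ofWord_surjective z
  rw [← ArtinMonoid.ofWord_cons, ArtinMonoid.ofWord_eq_iff, ← toBraid_eq_iff] at hx hy
  exact ⟨toBraid w, hx, hy⟩

theorem exists_eq_of_adj {i j : Fin (n - 1)}
    (ha : (SimpleGraph.pathGraph (n - 1)).Adj i j) {x y : PosBraid n}
    (h : atom i * x = atom j * y) :
    ∃ z, x = atom j * (atom i * z) ∧ y = atom i * (atom j * z) := by
  obtain ⟨u, rfl⟩ := toBraid_surjective n x
  obtain ⟨v, rfl⟩ := toBraid_surjective n y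
  obtain ⟨z, hx, hy⟩ := (complement_of_toBraid_eq h).of_adj ha
  obtain ⟨w, rfl⟩ := ArtinMonoid.ofWord_surjective z
  rw [← ArtinMonoid.ofWord_cons, ← ArtinMonoid.ofWord_cons, ArtinMonoid.ofWord_eq_iff,
    ← toBraid_eq_iff] at hx hy
  exact ⟨toBraid w, hx, hy⟩

/-! ### Greatest common prefixes and prefixes of a central braid -/

/-- Two atoms have a conditional least common multiple. -/
theorem exists_lcm_atoms (i j : Fin (n - 1)) : ∃ r s : PosBraid n, atom i * r = atom j * s ∧
    ∀ x y, atom i * x = atom j * y → ∃ z, x = r * z ∧ y = s * z := by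
  by_cases hij : i = j
  · subst hij
    exact ⟨1, 1, rfl, fun x y h => ⟨x, (one_mul x).symm, by rw [one_mul, mul_left_cancel h]⟩⟩
  by_cases ha : (SimpleGraph.pathGraph (n - 1)).Adj i j
  · refine ⟨atom j * atom i, atom i * atom j, ?_, fun x y h => ?_⟩
    · rw [← mul_assoc, ← mul_assoc, atom_braid ha]
    · simpa only [mul_assoc] using exists_eq_of_adj ha h
  · exact ⟨atom j, atom i, atom_comm hij ha, fun x y h => exists_eq_of_not_adj hij ha h⟩

/-- Induction on the length of `x`: strip a common first atom and put it back in front of the gcd of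
the remainders. Least common multiples of atoms show that the choice of atom does not matter. -/
theorem exists_prefix_gcd (x y : PosBraid n) :
    ∃ g, IsPrefix g x ∧ IsPrefix g y ∧ ∀ e, IsPrefix e x → IsPrefix e y → IsPrefix e g := by
  obtain ⟨u, rfl⟩ := toBraid_surjective n x
  induction hl : u.length generalizing u y with
  | zero =>
    obtain rfl := List.length_eq_zero_iff.1 hl
    exact ⟨1, ⟨1, one_mul _⟩, ⟨y, one_mul _⟩, fun e h _ => h⟩
  | succ l ih =>
    by_cases hs : ∃ i : Fin (n - 1), IsPrefix (atom i) (toBraid u) ∧ IsPrefix (atom i) y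
    · obtain ⟨i, ⟨x', hx⟩, ⟨y', rfl⟩⟩ := hs
      have descend : ∀ j (x'' : PosBraid n) (y'' : PosBraid n), atom j * x'' = toBraid u →
          ∃ g, IsPrefix g x'' ∧ IsPrefix g y'' ∧
            ∀ e, IsPrefix e x'' → IsPrefix e y'' → IsPrefix e g := by
        intro j x'' y'' h
        obtain ⟨v, rfl⟩ := toBraid_surjective n x''
        refine ih y'' v ?_
        have := length_eq_of_toBraid_eq (v := j :: v) h
        rw [List.length_cons, hl] at this
        exact Nat.succ.inj this
      obtain ⟨g, ⟨a, rfl⟩, ⟨b, rfl⟩, hg⟩ := descend i x' y' hx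
      refine ⟨atom i * g, ⟨a, by rw [mul_assoc, hx]⟩, ⟨b, by rw [mul_assoc]⟩, ?_⟩
      rintro e ⟨p, hp⟩ ⟨q, hq⟩
      obtain ⟨w, rfl⟩ := toBraid_surjective n e
      obtain _ | ⟨j, w⟩ := w
      · exact ⟨_, one_mul _⟩
      rw [toBraid_cons, mul_assoc] at hp hq
      obtain ⟨g', ⟨a', ha⟩, ⟨b', hb⟩, hg'⟩ := descend j (toBraid w * p) (toBraid w * q) hp
      obtain ⟨r, s, hrs, hlcm⟩ := exists_lcm_atoms i j
      obtain ⟨z, hz, hz'⟩ := hlcm _ _ (hx.trans hp.symm)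
      obtain ⟨z₁, hz₁, hz₁'⟩ := hlcm _ _ hq.symm
      -- Both `i` and `j` begin `x` and `y`, hence so does their lcm i r = j s. So `s` divides the
      -- gcd s t obtained by stripping `j`, and j s t = i r t is a common prefix that starts with
      -- `i`, to which maximality of `g` applies.
      obtain ⟨t, rfl⟩ := hg' s ⟨z, hz'.symm⟩ ⟨z₁, hz₁'.symm⟩
      obtain ⟨t', ht'⟩ := hg' (toBraid w) ⟨p, rfl⟩ ⟨q, rfl⟩
      obtain ⟨k, hk⟩ := hg (r * t)
        ⟨a', mul_left_cancel (a := atom i) (by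
          rw [hx, ← hp, ← ha, ← mul_assoc, ← mul_assoc, hrs, ← mul_assoc, ← mul_assoc])⟩
        ⟨b', mul_left_cancel (a := atom i) (by
          rw [← hq, ← hb, ← mul_assoc, ← mul_assoc, hrs, ← mul_assoc, ← mul_assoc])⟩
      refine ⟨t' * k, ?_⟩
      rw [toBraid_cons, ← hk, mul_assoc, ← mul_assoc (toBraid w), ht', ← mul_assoc, ← mul_assoc,
        ← mul_assoc, ← mul_assoc, hrs]
    · refine ⟨1, ⟨_, one_mul _⟩, ⟨y, one_mul _⟩, ?_⟩
      rintro e ⟨p, hp⟩ ⟨q, rfl⟩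
      obtain ⟨w, rfl⟩ := toBraid_surjective n e
      obtain _ | ⟨j, w⟩ := w
      · exact ⟨1, one_mul _⟩
      rw [toBraid_cons, mul_assoc] at hp
      rw [toBraid_cons, mul_assoc] at hs
      exact absurd ⟨j, ⟨_, hp⟩, ⟨_, rfl⟩⟩ hs

theorem exists_central_multiple (n : ℕ) :
    ∃ c : PosBraid n, (∀ x, x * c = c * x) ∧ ∀ i, IsPrefix (atom i) c := by
  let s : ℕ → PosBraid n := fun i => if h : i < n - 1 then atom ⟨i, h⟩ else 1
  have hs : ∀ i : Fin (n - 1), s i = atom i := fun i => dif_pos i.2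
  have hrel : BraidRelations s (n - 1) := by
    refine ⟨fun i j hij hj => ?_, fun i hi => ?_⟩
    · rw [hs ⟨j, hj⟩, hs ⟨i, by omega⟩]
      refine atom_comm ?_ ?_
      · rw [Ne, Fin.mk.injEq]
        omega
      · rw [SimpleGraph.pathGraph_adj]
        dsimp only
        omega
    · rw [hs ⟨i + 1, hi⟩, hs ⟨i, by omega⟩]
      refine atom_braid ?_
      rw [SimpleGraph.pathGraph_adj]
      exact .inl rfl
  refine ⟨ascProd s (n - 1) ^ (n - 1 + 1), fun x => ?_, fun i => ?_⟩
  · obtain ⟨u, rfl⟩ := toBraid_surjective n x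
    induction u with
    | nil => rw [toBraid_nil, one_mul, mul_one]
    | cons a u ih =>
      rw [toBraid_cons, mul_assoc, ih, ← mul_assoc, ← hs, hrel.ascProd_pow_comm a.2, mul_assoc]
  · rw [← hs]
    exact hrel.exists_mul_eq_ascProd_pow i.2

theorem finite_prefixes (c : PosBraid n) : {d | IsPrefix d c}.Finite := by
  obtain ⟨u, rfl⟩ := toBraid_surjective n c
  refine ((List.finite_length_le (Fin (n - 1)) u.length).image toBraid).subset ?_
  rintro d ⟨e, he⟩
  obtain ⟨v, rfl⟩ := toBraid_surjective n d
  obtain ⟨w, rfl⟩ := toBraid_surjective n e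
  rw [← toBraid_append] at he
  have := length_eq_of_toBraid_eq he
  rw [List.length_append] at this
  exact ⟨v, show v.length ≤ u.length by omega, rfl⟩

/-- The prefixes of a central multiple of the atoms are closed under complements. -/
theorem exists_prefix_complement {c : PosBraid n} (hc : ∀ x, x * c = c * x)
    (hatom : ∀ i, IsPrefix (atom i) c) (x : Word n) {d β : PosBraid n} (hd : IsPrefix d c)
    (h : IsPrefix d (toBraid x * β)) :
    ∃ e, IsPrefix e c ∧ IsPrefix e β ∧ IsPrefix d (toBraid x * e) := by
  induction x generalizing d with
  | nil =>
    rw [toBraid_nil, one_mul] at h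
    exact ⟨d, hd, h, 1, by rw [toBraid_nil, one_mul, mul_one]⟩
  | cons a x ih =>
    rw [toBraid_cons, mul_assoc] at h
    -- The gcd with `c` contains both `d` and `a`, so it has the form a d'. As `c` is central, a d'
    -- q = c gives d' q a = c, so `d'` is again a prefix of `c` and the induction continues with it.
    obtain ⟨g, ⟨p, hp⟩, ⟨q, hq⟩, hg⟩ := exists_prefix_gcd (atom a * (toBraid x * β)) c
    obtain ⟨d', rfl⟩ := hg (atom a) ⟨_, rfl⟩ (hatom a)
    rw [mul_assoc] at hp hq
    obtain ⟨e, he, heβ, k, hk⟩ := ih (d := d')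
      ⟨q * atom a, mul_left_cancel (a := atom a) (by
        rw [← mul_assoc, ← mul_assoc, mul_assoc (atom a), hq, ← hc])⟩ ⟨p, mul_left_cancel hp⟩
    obtain ⟨l, hl⟩ := hg d h hd
    exact ⟨e, he, heβ, l * k, by rw [← mul_assoc, hl, mul_assoc, hk, toBraid_cons, mul_assoc]⟩

end BraidLex

/-! ### Lexicographic representatives and prefixes -/

theorem List.cons_le_cons_iff_of_linearOrder {α : Type*} [LinearOrder α] {a b : α} {x y : List α} :
    a :: x ≤ b :: y ↔ a < b ∨ a = b ∧ x ≤ y := by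
  have h : x ≤ y ↔ ¬ y < x := not_lt.symm
  rw [← not_lt, List.cons_lt_cons_iff, h]
  rcases lt_trichotomy a b with h | h | h
  · simp [h, h.ne', h.not_gt]
  · simp [h]
  · simp [h, h.ne', h.not_gt]

namespace BraidLex

variable {n : ℕ}

theorem mem_lexLanguage_iff {w : Word n} :
    w ∈ lexLanguage n ↔ ∀ v, toBraid v = toBraid w → w ≤ v := by
  constructor
  · rintro ⟨β, rfl⟩ v hv
    exact (lexRep_isLeast β).2 (hv.trans (lexRep_isLeast β).1)
  · intro h
    exact ⟨toBraid w, (lexRep_isLeast (toBraid w)).unique ⟨rfl, fun v hv => h v hv⟩⟩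

theorem toBraid_lexRep (β : PosBraid n) : toBraid (lexRep β) = β := (lexRep_isLeast β).1

theorem lexRep_toBraid {w : Word n} (h : w ∈ lexLanguage n) : lexRep (toBraid w) = w := by
  obtain ⟨β, rfl⟩ := h
  rw [toBraid_lexRep]

theorem lexRep_mem (β : PosBraid n) : lexRep β ∈ lexLanguage n := ⟨β, rfl⟩

theorem nil_mem_lexLanguage : ([] : Word n) ∈ lexLanguage n :=
  mem_lexLanguage_iff.2 fun v _ => not_lt.1 (List.not_lt_nil v)

/-- A word is a lex-representative if each of its letters is the smallest atom that is a prefix of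
the braid represented by the rest of the word. -/
theorem cons_mem_lexLanguage_iff {a : Fin (n - 1)} {x : Word n} :
    a :: x ∈ lexLanguage n ↔
      x ∈ lexLanguage n ∧ ∀ j, IsPrefix (atom j) (toBraid (a :: x)) → a ≤ j := by
  simp only [mem_lexLanguage_iff]
  constructor
  · intro h
    refine ⟨fun v hv => ?_, ?_⟩
    · have := h (a :: v) (by rw [toBraid_cons, toBraid_cons, hv])
      rw [List.cons_le_cons_iff_of_linearOrder] at this
      exact this.resolve_left (lt_irrefl a) |>.2
    · rintro j ⟨y, hy⟩
      obtain ⟨v, rfl⟩ := toBraid_surjective n y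
      have := h (j :: v) hy
      rw [List.cons_le_cons_iff_of_linearOrder] at this
      exact this.elim le_of_lt fun h => h.1.le
  · rintro ⟨hx, ha⟩ v hv
    obtain _ | ⟨j, y⟩ := v
    · have := length_eq_of_toBraid_eq hv
      simp at this
    rw [List.cons_le_cons_iff_of_linearOrder]
    rcases (ha j ⟨toBraid y, hv⟩).lt_or_eq with h | rfl
    · exact .inl h
    · exact .inr ⟨rfl, hx y (mul_left_cancel hv)⟩

theorem append_mem_lexLanguage_iff {w v : Word n} :
    w ++ v ∈ lexLanguage n ↔ v ∈ lexLanguage n ∧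
      ∀ a x, a :: x <:+ w → ∀ j, IsPrefix (atom j) (toBraid (a :: x) * toBraid v) → a ≤ j := by
  induction w with
  | nil => simp
  | cons b w ih =>
    rw [List.cons_append, cons_mem_lexLanguage_iff, ih, ← List.cons_append, toBraid_append,
      and_assoc]
    refine and_congr_right fun _ => ⟨?_, fun h => ⟨fun a x hax => h a x ?_, h b w ?_⟩⟩
    · rintro ⟨h, h'⟩ a x hax
      rcases List.suffix_cons_iff.1 hax with hax | hax
      · obtain ⟨rfl, rfl⟩ := List.cons_eq_cons.1 hax
        exact h'
      · exact h a x hax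
    · exact hax.trans (List.suffix_cons b w)
    · exact List.suffix_refl _

theorem mem_lexLanguage_of_append {w v : Word n} (h : w ++ v ∈ lexLanguage n) :
    w ∈ lexLanguage n := by
  induction w with
  | nil => exact nil_mem_lexLanguage
  | cons a w ih =>
    rw [List.cons_append, cons_mem_lexLanguage_iff] at h
    refine cons_mem_lexLanguage_iff.2 ⟨ih h.1, ?_⟩
    rintro j ⟨y, hy⟩
    exact h.2 j ⟨y * toBraid v, by rw [← mul_assoc, hy, ← toBraid_append, List.cons_append]⟩

/-! ### Forbidden prefixes: finiteness and automata -/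

theorem mem_forbidden_iff {w : Word n} {α : PosBraid n} :
    α ∈ forbidden w ↔
      ∃ a x, a :: x <:+ w ∧ ∃ j, IsPrefix (atom j) (toBraid (a :: x) * α) ∧ j < a := by
  change ¬ (w ++ lexRep α ∈ lexLanguage n) ↔ _
  rw [append_mem_lexLanguage_iff, toBraid_lexRep]
  simp only [lexRep_mem, true_and, not_forall, not_le, exists_prop]

/-- The divisibility that makes `α` forbidden is already caused by a common prefix of `α` and `c`;
minimality makes that prefix equal to `α`. -/
theorem minForbidden_subset {c : PosBraid n} (hc : ∀ x, x * c = c * x)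
    (hatom : ∀ i, IsPrefix (atom i) c) (w : Word n) : minForbidden w ⊆ {d | IsPrefix d c} := by
  rintro α ⟨hα, hmin⟩
  obtain ⟨a, x, hax, j, hj, hja⟩ := mem_forbidden_iff.1 hα
  obtain ⟨e, he, heα, hje⟩ := exists_prefix_complement hc hatom (a :: x) (hatom j) hj
  rw [← hmin e (mem_forbidden_iff.2 ⟨a, x, hax, j, hje, hja⟩) heα]
  exact he

theorem finite_minForbidden (n : ℕ) : {S : Set (PosBraid n) |
    ∃ w ∈ lexLanguage n, minForbidden w = S}.Finite := by
  obtain ⟨c, hc, hatom⟩ := exists_central_multiple n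
  refine (finite_prefixes c).finite_subsets.subset ?_
  rintro _ ⟨w, -, rfl⟩
  exact minForbidden_subset hc hatom w

/-- Myhill–Nerode: `forbidden w`, and with it `minForbidden w`, is determined by the state reached
on reading `w`. -/
theorem ncard_minForbidden_le_card {Q : Type*} [Fintype Q] (Γ : DFA (Fin (n - 1)) Q)
    (h : Γ.accepts = lexLanguage n) : Set.ncard {S : Set (PosBraid n) |
      ∃ w ∈ lexLanguage n, minForbidden w = S} ≤ Fintype.card Q := by
  let F : Q → Set (PosBraid n) := fun q => {α | lexRep α ∉ Γ.acceptsFrom q}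
  let f : Q → Set (PosBraid n) := fun q => {α | α ∈ F q ∧ ∀ β ∈ F q, IsPrefix β α → β = α}
  have hF : ∀ w, forbidden w = F (Γ.eval w) := fun w => by
    ext α
    change w ++ lexRep α ∉ lexLanguage n ↔ _
    rw [← h, DFA.mem_accepts, DFA.eval, DFA.evalFrom_of_append]
    rfl
  have hsub : {S : Set (PosBraid n) | ∃ w ∈ lexLanguage n, minForbidden w = S} ⊆ Set.range f := by
    rintro _ ⟨w, -, rfl⟩
    refine ⟨Γ.eval w, ?_⟩
    rw [minForbidden, hF]
  refine (Set.ncard_le_ncard hsub (Set.finite_range f)).trans ?_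
  rw [← Set.image_univ]
  refine (Set.ncard_image_le Set.finite_univ).trans ?_
  rw [Set.ncard_univ, Nat.card_eq_fintype_card]

/-! ### The lower bound: words with descending letters -/

theorem singleton_mem_lexLanguage (i : Fin (n - 1)) : [i] ∈ lexLanguage n := by
  refine mem_lexLanguage_iff.2 fun v hv => ?_
  have hlen := length_eq_of_toBraid_eq hv
  obtain ⟨k, rfl⟩ := List.length_eq_one_iff.1 hlen
  have := ((wordEq_of_toBraid_eq hv).mem_iff i).2 (List.mem_singleton_self i)
  rw [List.mem_singleton.1 this]

theorem toBraid_singleton (i : Fin (n - 1)) : toBraid [i] = atom i := mul_one _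

theorem lexRep_atom (i : Fin (n - 1)) : lexRep (atom i) = [i] := by
  rw [← toBraid_singleton, lexRep_toBraid (singleton_mem_lexLanguage i)]

theorem atom_mem_minForbidden_iff {w : Word n} (hw : w ∈ lexLanguage n) (i : Fin (n - 1)) :
    atom i ∈ minForbidden w ↔ w ++ [i] ∉ lexLanguage n := by
  rw [← lexRep_atom]
  refine ⟨fun h => h.1, fun h => ⟨h, ?_⟩⟩
  rintro β hβ ⟨γ, h⟩
  obtain ⟨u, rfl⟩ := toBraid_surjective n β
  obtain ⟨v, rfl⟩ := toBraid_surjective n γ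
  obtain _ | ⟨j, u⟩ := u
  · refine absurd ?_ hβ
    rw [lexRep_toBraid nil_mem_lexLanguage, List.append_nil]
    exact hw
  · have := length_eq_of_toBraid_eq (v := j :: u ++ v) (w := [i]) (by
      rw [toBraid_append, h, toBraid_singleton])
    simp only [List.length_append, List.length_cons, List.length_nil] at this
    obtain rfl : v = [] := List.length_eq_zero_iff.1 (by omega)
    rw [← h, toBraid_nil, mul_one]

/-- The word `σ_k ^ e (k - 1) ⋯ σ_2 ^ e 1 σ_1 ^ e 0`. -/
def descWord (e : ℕ → ℕ) : (k : ℕ) → k ≤ n - 1 → Word n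
  | 0, _ => []
  | k + 1, hk => List.replicate (e k) ⟨k, hk⟩ ++ descWord e k (Nat.le_of_succ_le hk)

theorem lt_of_mem_descWord {e : ℕ → ℕ} {k : ℕ} {hk : k ≤ n - 1} {b : Fin (n - 1)}
    (hb : b ∈ descWord e k hk) : (b : ℕ) < k := by
  induction k with
  | zero => simp [descWord] at hb
  | succ k ih =>
    rw [descWord, List.mem_append] at hb
    rcases hb with hb | hb
    · rw [List.eq_of_mem_replicate hb]
      exact Nat.lt_succ_self k
    · exact (ih hb).trans (Nat.lt_succ_self k)

theorem descWord_suffix (e : ℕ → ℕ) {k l : ℕ} (h : k ≤ l) (hl : l ≤ n - 1) :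
    descWord (n := n) e k (h.trans hl) <:+ descWord e l hl := by
  induction l with
  | zero =>
    obtain rfl := Nat.le_zero.1 h
    exact List.suffix_refl _
  | succ l ih =>
    rcases Nat.le_succ_iff.1 h with h | rfl
    · exact (ih h _).trans (List.suffix_append _ _)
    · exact List.suffix_refl _

theorem mem_of_toBraid_eq_mul_atom_mul {u : Word n} {x y : PosBraid n} {a : Fin (n - 1)}
    (h : x * (atom a * y) = toBraid u) : a ∈ u := by
  obtain ⟨v, rfl⟩ := toBraid_surjective n x
  obtain ⟨w, rfl⟩ := toBraid_surjective n y
  rw [← toBraid_cons, ← toBraid_append] at h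
  refine ((wordEq_of_toBraid_eq h).mem_iff a).1 ?_
  simp

theorem pathGraph_adj_of_succ {a j : Fin (n - 1)} (h : (j : ℕ) + 1 = a) :
    (SimpleGraph.pathGraph (n - 1)).Adj a j := by
  rw [SimpleGraph.pathGraph_adj]
  exact .inr h

/-- If σ_a begins σ_j^s u, the lcm of σ_a and σ_j shows that it begins σ_j^{s-1} u as well.
Descending to s = 1, the braid of `u` begins with σ_aσ_j, although `u` has no letter `j`. -/
theorem not_isPrefix_succ {u : Word n} {a j : Fin (n - 1)} (haj : (j : ℕ) + 1 = a)
    (hu : j ∉ u) {s : ℕ} (hs : 1 ≤ s) :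
    ¬ IsPrefix (atom a) (toBraid (List.replicate s j ++ u)) := by
  rintro ⟨y, hy⟩
  induction s, hs using Nat.le_induction generalizing y with
  | base =>
    obtain ⟨z, -, hz⟩ := exists_eq_of_adj (pathGraph_adj_of_succ haj) hy
    exact hu (mem_of_toBraid_eq_mul_atom_mul hz.symm)
  | succ s hs ih =>
    rw [List.replicate_succ, List.cons_append, toBraid_cons] at hy
    obtain ⟨z, -, hz⟩ := exists_eq_of_adj (pathGraph_adj_of_succ haj) hy
    exact ih _ hz.symm

theorem not_isPrefix_of_lt {e : ℕ → ℕ} (he : ∀ i, 1 ≤ e i) {t : Fin (n - 1)}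
    (ht : ∀ b, b + 1 = (t : ℕ) → 2 ≤ e b) {k : ℕ} (hk : k < n - 1) {r : ℕ} (hr : 1 ≤ r)
    {j : Fin (n - 1)} (hj : (j : ℕ) < k) :
    ¬ IsPrefix (atom j)
      (toBraid (List.replicate r ⟨k, hk⟩ ++ (descWord e k hk.le ++ [t]))) := by
  induction k generalizing r j with
  | zero => omega
  | succ k ihk =>
    rintro ⟨y, hy⟩
    have hej := he k
    induction r, hr using Nat.le_induction generalizing y with
    | base =>
      rw [List.replicate_one, List.singleton_append, toBraid_cons] at hy
      rw [descWord, List.append_assoc] at hy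
      rcases Nat.lt_succ_iff_lt_or_eq.1 hj with hj | hj
      · obtain ⟨z, -, hz⟩ := exists_eq_of_not_adj (by rw [Ne, Fin.ext_iff]; dsimp only; omega)
          (by rw [SimpleGraph.pathGraph_adj]; dsimp only; omega) hy
        exact ihk _ hej hj ⟨z, hz.symm⟩
      · obtain rfl : j = ⟨k, Nat.lt_of_succ_lt hk⟩ := Fin.ext hj
        obtain ⟨z, -, hz⟩ := exists_eq_of_adj (pathGraph_adj_of_succ rfl).symm hy
        obtain ⟨s, hs⟩ : ∃ s, e k = s + 1 := ⟨e k - 1, by omega⟩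
        rw [hs, List.replicate_succ, List.cons_append, toBraid_cons] at hz
        have hz' := mul_left_cancel hz
        -- After cancelling one letter `k`, the atom `k + 1` begins a word of `e k - 1` letters `k`,
        -- smaller letters, and `t`. Only `t` can supply `k + 1`, and in that case `ht` leaves at
        -- least one `k` in front to block it.
        by_cases hta : (t : ℕ) = k + 1
        · refine not_isPrefix_succ (a := ⟨k + 1, hk⟩) rfl ?_ ?_ ⟨z, hz'.symm⟩
          · rw [List.mem_append, List.mem_singleton, Fin.ext_iff]
            rintro (h | h)
            · exact lt_irrefl _ (lt_of_mem_descWord h)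
            · dsimp only at h
              omega
          · have := ht k hta.symm
            omega
        · have h := mem_of_toBraid_eq_mul_atom_mul ((one_mul _).trans hz'.symm)
          simp only [List.mem_append, List.mem_singleton] at h
          rcases h with h | h | h
          · have := congrArg Fin.val (List.eq_of_mem_replicate h)
            dsimp only at this
            omega
          · have := lt_of_mem_descWord h
            dsimp only at this
            omega
          · exact hta (congrArg Fin.val h).symm
    | succ r hr ihr =>
      rw [List.replicate_succ, List.cons_append, toBraid_cons] at hy
      rcases Nat.lt_succ_iff_lt_or_eq.1 hj with hj | hj
      · obtain ⟨z, -, hz⟩ := exists_eq_of_not_adj (by rw [Ne, Fin.ext_iff]; dsimp only; omega)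
          (by rw [SimpleGraph.pathGraph_adj]; dsimp only; omega) hy
        exact ihr _ hz.symm
      · obtain ⟨z, -, hz⟩ := exists_eq_of_adj (pathGraph_adj_of_succ (by rw [hj])).symm hy
        exact ihr _ hz.symm

theorem descWord_append_mem {e : ℕ → ℕ} (he : ∀ i, 1 ≤ e i) {t : Fin (n - 1)}
    (ht : ∀ b, b + 1 = (t : ℕ) → 2 ≤ e b) {k : ℕ} (hk : k ≤ n - 1) :
    descWord e k hk ++ [t] ∈ lexLanguage n := by
  induction k with
  | zero => exact singleton_mem_lexLanguage t
  | succ k ih =>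
    rw [descWord, List.append_assoc]
    generalize e k = r
    induction r with
    | zero => exact ih _
    | succ r ihr =>
      rw [List.replicate_succ, List.cons_append, cons_mem_lexLanguage_iff]
      refine ⟨ihr, fun j hj => ?_⟩
      by_contra! hlt
      exact not_isPrefix_of_lt he ht hk (Nat.le_add_left 1 r) hlt hj

theorem toBraid_mul_atom {u : Word n} {t : Fin (n - 1)} (h : ∀ b ∈ u, (b : ℕ) + 2 ≤ t) :
    toBraid u * atom t = atom t * toBraid u := by
  induction u with
  | nil => rw [toBraid_nil, one_mul, mul_one]
  | cons a u ih =>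
    have ha := h a List.mem_cons_self
    rw [toBraid_cons, mul_assoc, ih fun b hb => h b (List.mem_cons_of_mem a hb), ← mul_assoc,
      atom_comm, mul_assoc]
    · rintro rfl
      omega
    · rw [SimpleGraph.pathGraph_adj]
      omega

/-- The new σ_{b+1} commutes past all letters below `b` and meets the single `b`; the braid relation
then exposes the smaller first letter `b`. -/
theorem descWord_append_not_mem {e : ℕ → ℕ} {b : ℕ} (hb : b + 1 < n - 1) (h₀ : e b = 1)
    (h₁ : 1 ≤ e (b + 1)) : descWord e (n - 1) le_rfl ++ [⟨b + 1, hb⟩] ∉ lexLanguage n := by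
  rw [append_mem_lexLanguage_iff]
  rintro ⟨-, h⟩
  have hsuff : (⟨b + 1, hb⟩ : Fin (n - 1)) :: ⟨b, by omega⟩ :: descWord e b (by omega) <:+
      descWord e (n - 1) le_rfl := by
    refine List.IsSuffix.trans ?_ (descWord_suffix e (k := b + 2) hb le_rfl)
    rw [descWord, descWord, h₀]
    obtain ⟨s, hs⟩ : ∃ s, e (b + 1) = s + 1 := ⟨e (b + 1) - 1, by omega⟩
    rw [hs, List.replicate_succ', List.append_assoc]
    exact List.suffix_append _ _
  have := h _ _ hsuff ⟨b, by omega⟩ ⟨atom ⟨b + 1, hb⟩ *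
    (atom ⟨b, by omega⟩ * toBraid (descWord e b (by omega))), ?_⟩
  · simp at this
  · rw [toBraid_singleton, toBraid_cons, toBraid_cons, mul_assoc, mul_assoc,
      toBraid_mul_atom fun c hc => ?_]
    · simp only [← mul_assoc]
      rw [atom_braid]
      exact (pathGraph_adj_of_succ rfl).symm
    · have := lt_of_mem_descWord hc
      dsimp only
      omega

/-- The exponents `2` on `S` and `1` elsewhere. -/
def exponents (S : Finset ℕ) (i : ℕ) : ℕ := if i ∈ S then 2 else 1

theorem one_le_exponents (S : Finset ℕ) (i : ℕ) : 1 ≤ exponents S i := by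
  rw [exponents]
  split <;> norm_num

/-- The language is closed under prefixes of words, and appending the lowest generator puts no
condition on the exponents. -/
theorem descWord_exponents_mem (hn : 1 < n) (S : Finset ℕ) :
    descWord (n := n) (exponents S) (n - 1) le_rfl ∈ lexLanguage n :=
  mem_lexLanguage_of_append <| descWord_append_mem (one_le_exponents S) (t := ⟨0, by omega⟩)
    (fun b hb => absurd hb (Nat.succ_ne_zero b)) (le_refl (n - 1))

theorem mem_iff_atom_not_mem_minForbidden (hn : 1 < n) (S : Finset ℕ) {b : ℕ}
    (hb : b + 1 < n - 1) : b ∈ S ↔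
      (atom ⟨b + 1, hb⟩ : PosBraid n) ∉ minForbidden (descWord (exponents S) (n - 1) le_rfl) := by
  rw [atom_mem_minForbidden_iff (descWord_exponents_mem hn S), not_not]
  refine ⟨fun h => descWord_append_mem (one_le_exponents S) (fun c hc => ?_) _, fun h => ?_⟩
  · obtain rfl : c = b := Nat.succ.inj hc
    rw [exponents, if_pos h]
  · by_contra hS
    exact descWord_append_not_mem hb (if_neg hS) (one_le_exponents S _) h

theorem two_pow_le_ncard_minForbidden (hn : 1 < n) : 2 ^ (n - 2) ≤
    Set.ncard {S : Set (PosBraid n) | ∃ w ∈ lexLanguage n, minForbidden w = S} := by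
  let f : Finset ℕ → Set (PosBraid n) := fun S =>
    minForbidden (descWord (exponents S) (n - 1) le_rfl)
  have hinj : Set.InjOn f ((Finset.range (n - 2)).powerset : Set (Finset ℕ)) := by
    intro S hS T hT h
    rw [Finset.mem_coe, Finset.mem_powerset] at hS hT
    ext b
    by_cases hb : b < n - 2
    · rw [mem_iff_atom_not_mem_minForbidden hn S (by omega),
        mem_iff_atom_not_mem_minForbidden hn T (by omega)]
      exact not_congr (by rw [show minForbidden _ = minForbidden _ from h])
    · exact iff_of_false (fun h => hb (Finset.mem_range.1 (hS h)))
        (fun h => hb (Finset.mem_range.1 (hT h)))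
  calc 2 ^ (n - 2) = ((Finset.range (n - 2)).powerset : Set (Finset ℕ)).ncard := by
        rw [Set.ncard_coe_finset, Finset.card_powerset, Finset.card_range]
    _ = (f '' ((Finset.range (n - 2)).powerset : Set (Finset ℕ))).ncard :=
        hinj.ncard_image.symm
    _ ≤ _ := by
        refine Set.ncard_le_ncard ?_ (finite_minForbidden n)
        rintro _ ⟨S, -, rfl⟩
        exact ⟨_, descWord_exponents_mem hn S, rfl⟩

end BraidLex

theorem proposition5p5 (n : ℕ) (hn : 1 < n) :
    (Set.Finite {S : Set (BraidLex.PosBraid n) |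
        ∃ w ∈ BraidLex.lexLanguage n, BraidLex.minForbidden w = S} ∧
      2 ^ (n - 2) ≤ Set.ncard {S : Set (BraidLex.PosBraid n) |
        ∃ w ∈ BraidLex.lexLanguage n, BraidLex.minForbidden w = S}) ∧
    (∀ (Q : Type*) [Fintype Q] (Γ : DFA (Fin (n - 1)) Q),
      Γ.accepts = BraidLex.lexLanguage n → 2 ^ (n - 2) ≤ Fintype.card Q) :=
  ⟨⟨BraidLex.finite_minForbidden n, BraidLex.two_pow_le_ncard_minForbidden hn⟩,
    fun _ _ Γ h => (BraidLex.two_pow_le_ncard_minForbidden hn).trans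
      (BraidLex.ncard_minForbidden_le_card Γ h)⟩
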